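/- Let $\Delta\notin\mathbb N_0=\{0,1,2,\dots\}$ be an additional state and $\mathbb N_\Delta=\mathbb N_0\cup\{\Delta\}$, with the conventions $\Delta+k=k+\Delta=\Delta$ for $k\in\mathbb N_\Delta$ and $\sum_{j=1}^{\Delta}k_j=\Delta$ for $k_j\in\mathbb N_\Delta$. For each $n\ge 1$ let $f_n=(f_n[k])_{k\ge 0}$ be a possibly defective distribution on $\mathbb N_0$, that is, $f_n[k]\ge 0$ and $\sum_{k\ge 0}f_n[k]\le 1$, and assume that $0<f_n'(1)=\sum_{k\ge 0}k f_n[k]<\infty$. Let $\{X_{nj}: n,j\ge 1\}$ be independent $\mathbb N_\Delta$-valued random variables on a probability space $(\Omega,\mathcal A,P)$ with $P[X_{nj}=k]=f_n[k]$ for $k\in\mathbb N_0$ (hence $P[X_{nj}=\Delta]=1-\sum_{k\ge0}f_n[k]$), and let $\{Z_n\}_{n\ge 0}$ be the defective Galton–Watson process in the varying environment $\{f_n\}_{n\ge 1}$ defined by $$Z_0=1,\qquad Z_n=\sum_{j=1}^{Z_{n-1}}X_{nj},\quad n\ge 1.$$ Then there exists a random variable $Z_\infty$ with values in $\mathbb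 N_\Delta\cup\{\infty\}$ (the one-point compactification of the discrete space $\mathbb N_\Delta$, so that a sequence in $\mathbb N_\Delta$ converges to $z\in\mathbb N_\Delta$ if it is eventually equal to $z$, and to $\infty$ if it eventually leaves every finite subset of $\mathbb N_\Delta$) such that $Z_n\to Z_\infty$ almost surely as $n\to\infty$. Moreover, $$P[0<Z_\infty<\infty]>0\quad\Longleftrightarrow\quad\sum_{n=1}^\infty(1-f_n[1])<\infty,$$ where $\{0<Z_\infty<\infty\}$ is the event that $Z_\infty$ is a positive integer (in particular $Z_\infty\neq\Delta$). -/

import Mathlib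

open MeasureTheory ProbabilityTheory Filter Topology
open scoped ENNReal

/-- The state space `ℕ₀ ∪ {Δ}`. -/
inductive DeltaNat : Type where
  | nat (k : ℕ) : DeltaNat
  | delta : DeltaNat

namespace DeltaNat

/-- Addition on `ℕ₀ ∪ {Δ}`: the usual one on `ℕ₀`, and `Δ + k = k + Δ = Δ`. -/
def add : DeltaNat → DeltaNat → DeltaNat
  | nat a, nat b => nat (a + b)
  | _, _ => delta

instance : Add DeltaNat := ⟨add⟩

instance : Zero DeltaNat := ⟨nat 0⟩

@[simp] theorem nat_add_nat (a b : ℕ) : nat a + nat b = nat (a + b) := rfl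

@[simp] theorem delta_add (x : DeltaNat) : delta + x = delta := by
  cases x <;> rfl

@[simp] theorem add_delta (x : DeltaNat) : x + delta = delta := by
  cases x <;> rfl

theorem zero_def : (0 : DeltaNat) = nat 0 := rfl

instance : AddCommMonoid DeltaNat where
  add_assoc a b c := by cases a <;> cases b <;> cases c <;> simp [Nat.add_assoc]
  zero_add a := by cases a <;> simp [zero_def]
  add_zero a := by cases a <;> simp [zero_def]
  add_comm a b := by cases a <;> cases b <;> simp [Nat.add_comm]
  nsmul := nsmulRec

/-- `ℕ₀ ∪ {Δ}` is a discrete space. -/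
instance : TopologicalSpace DeltaNat := ⊥

instance : DiscreteTopology DeltaNat := ⟨rfl⟩

/-- Every subset of `ℕ₀ ∪ {Δ}` is measurable. -/
instance : MeasurableSpace DeltaNat := ⊤

end DeltaNat

/-- The space `ℕ₀ ∪ {Δ} ∪ {∞}`, the one-point compactification of the discrete space `ℕ₀ ∪ {Δ}`:
a sequence in `ℕ₀ ∪ {Δ}` converges to a point of `ℕ₀ ∪ {Δ}` iff it is eventually equal to it, and
to `∞` iff it eventually leaves every finite subset of `ℕ₀ ∪ {Δ}`. -/
abbrev ExtDeltaNat : Type := OnePoint DeltaNat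

instance : MeasurableSpace ExtDeltaNat := borel ExtDeltaNat

instance : BorelSpace ExtDeltaNat := ⟨rfl⟩

/-- A possibly defective distribution on `ℕ₀`: weights `f[k] ≥ 0` with `∑ k, f[k] ≤ 1`.
The defect `1 - ∑ k, f[k]` is the mass of `Δ`. -/
structure DefectiveDist where
  weight : ℕ → ℝ≥0∞
  tsum_weight_le_one : ∑' k, weight k ≤ 1

/-- `f'(1) = ∑ k, k f[k] ∈ [0, ∞]`, the derivative at `1` (from the left) of the generating
function `f(s) = ∑ k, f[k] s ^ k`. -/
noncomputable def DefectiveDist.derivOne (f : DefectiveDist) : ℝ≥0∞ :=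
  ∑' k : ℕ, (k : ℝ≥0∞) * f.weight k

/-- The random sum `∑_{j < z} x j`, for `z ∈ ℕ₀ ∪ {Δ}`, with the convention
that a sum with `Δ` terms equals `Δ`. -/
def deltaSum (x : ℕ → DeltaNat) : DeltaNat → DeltaNat
  | .nat m => ∑ j ∈ Finset.range m, x j
  | .delta => .delta

/-- `X n j` is the contribution to generation `n + 1` of the individual number `j` of
generation `n` (with `n` and `j` starting from `0`); it has law `f n`. -/
structure IsOffspringFamily {Ω : Type*} [MeasurableSpace Ω] (P : Measure Ω)
    (f : ℕ → DefectiveDist) (X : ℕ → ℕ → Ω → DeltaNat) : Prop where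
  measurable : ∀ n j, Measurable (X n j)
  indep : iIndepFun (fun p : ℕ × ℕ => X p.1 p.2) P
  law : ∀ n j k, P {ω | X n j ω = .nat k} = (f n).weight k

/-- `Z` is a defective Galton-Watson process in the varying environment `f`, where `f n` is the
law of the contributions of the individuals of generation `n` to generation `n + 1`. -/
def IsDGWPVE {Ω : Type*} [MeasurableSpace Ω] (P : Measure Ω)
    (f : ℕ → DefectiveDist) (Z : ℕ → Ω → DeltaNat) : Prop :=
  ∃ X : ℕ → ℕ → Ω → DeltaNat, IsOffspringFamily P f X ∧
    (∀ ω, Z 0 ω = .nat 1) ∧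
    ∀ n ω, Z (n + 1) ω = deltaSum (fun j => X n j ω) (Z n ω)

/-! The states `0` and `Δ` are absorbing, so everything turns on whether a positive integer `m` can
be visited infinitely often.

If `∑ (1 - f n [1]) < ∞`, Borel–Cantelli makes each of the first `m` individuals eventually have
exactly one child, so a late visit to `m` is never left (`ae_eventually_eq`). Independence of past
and future gives such trapping positive probability for some `m > 0`
(`exists_measure_eventually_eq_pos`).

Conversely, let `A`, the event of infinitely many visits to `m > 0`, have positive probability, and
let `E` be extinction. A sequence with `f n (s (n+1)) = s n` makes `s n ^ Z n` a bounded martingale,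
with limit `1` on `E` and mean `s 0`. Starting at `P E`, the limit must vanish on `A`; starting at
`P E + P A / 2`, it is positive on `A` but has integral at most `P A / 2` there, hence is below `1`
somewhere on `A`. Along the visits to `m` the first orbit then tends to `0` and the second to some
`σ ∈ (0, 1)`. A composition of the `f n` between two late visits thus nearly fixes both `0` and `σ`;
since its excess over the affine part is at most quadratic, its mass at `1` is close to `1`
(`tsum_lt_top_of_orbits`). A monotone potential turns this into summability
(`summable_of_frequently_iter_weight_one`). So if the series diverges, positive states are visited
only finitely often. -/

/-- Evaluation of a power series with coefficients in `[0, ∞]`. -/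
noncomputable def PowerSeries.ennrealEval (a : PowerSeries ℝ≥0∞) (s : ℝ≥0∞) : ℝ≥0∞ :=
  ∑' k, PowerSeries.coeff k a * s ^ k

theorem ENNReal.tsum_sum_antidiagonal (g : ℕ × ℕ → ℝ≥0∞) :
    ∑' n, ∑ p ∈ Finset.HasAntidiagonal.antidiagonal n, g p = ∑' p, g p := by
  rw [← (Finset.HasAntidiagonal.sigmaAntidiagonalEquivProd (A := ℕ)).tsum_eq g, ENNReal.tsum_sigma']
  refine tsum_congr fun n => ?_
  rw [tsum_fintype, ← Finset.sum_coe_sort]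
  rfl

theorem PowerSeries.ennrealEval_mul (a b : PowerSeries ℝ≥0∞) (s : ℝ≥0∞) :
    (a * b).ennrealEval s = a.ennrealEval s * b.ennrealEval s := by
  have h : ∀ n, PowerSeries.coeff n (a * b) * s ^ n = ∑ p ∈ Finset.HasAntidiagonal.antidiagonal n,
      (PowerSeries.coeff p.1 a * s ^ p.1) * (PowerSeries.coeff p.2 b * s ^ p.2) := by
    intro n
    rw [PowerSeries.coeff_mul, Finset.sum_mul]
    refine Finset.sum_congr rfl fun p hp => ?_
    rw [← Finset.HasAntidiagonal.mem_antidiagonal.1 hp, pow_add]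
    ring
  unfold PowerSeries.ennrealEval
  simp_rw [h]
  rw [ENNReal.tsum_sum_antidiagonal
    (fun p => (PowerSeries.coeff p.1 a * s ^ p.1) * (PowerSeries.coeff p.2 b * s ^ p.2)),
    ENNReal.tsum_prod (f := fun i j =>
      (PowerSeries.coeff i a * s ^ i) * (PowerSeries.coeff j b * s ^ j))]
  simp_rw [ENNReal.tsum_mul_left, ENNReal.tsum_mul_right]

theorem PowerSeries.ennrealEval_pow (a : PowerSeries ℝ≥0∞) (s : ℝ≥0∞) (n : ℕ) :
    (a ^ n).ennrealEval s = a.ennrealEval s ^ n := by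
  induction n with
  | zero =>
    unfold PowerSeries.ennrealEval
    rw [tsum_eq_single 0]
    · simp
    · intro k hk
      simp [PowerSeries.coeff_one, hk]
  | succ n ih => rw [pow_succ, PowerSeries.ennrealEval_mul, ih, pow_succ]

/-! ### Generating functions and their composition. -/

namespace DefectiveDist

/-- The generating function `f(s) = ∑ k, f[k] s ^ k`. -/
noncomputable def gf (f : DefectiveDist) (s : ℝ≥0∞) : ℝ≥0∞ := ∑' k, f.weight k * s ^ k

theorem gf_zero (f : DefectiveDist) : f.gf 0 = f.weight 0 := by
  unfold gf
  rw [tsum_eq_single 0]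
  · simp
  · intro k hk
    simp [hk]

theorem gf_one (f : DefectiveDist) : f.gf 1 = ∑' k, f.weight k := by simp [gf]

theorem gf_mono (f : DefectiveDist) : Monotone f.gf := fun s t h =>
  ENNReal.tsum_le_tsum fun k => by gcongr

theorem gf_le_one (f : DefectiveDist) {s : ℝ≥0∞} (hs : s ≤ 1) : f.gf s ≤ 1 :=
  (f.gf_mono hs).trans (f.gf_one ▸ f.tsum_weight_le_one)

theorem weight_le_one (f : DefectiveDist) (k : ℕ) : f.weight k ≤ 1 :=
  (ENNReal.le_tsum k).trans f.tsum_weight_le_one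

theorem weight_zero_add_weight_one_le (f : DefectiveDist) : f.weight 0 + f.weight 1 ≤ 1 := by
  have := (ENNReal.sum_le_tsum (f := f.weight) {0, 1}).trans f.tsum_weight_le_one
  simpa using this

/-- The point mass at `1`, whose generating function is the identity. -/
noncomputable def pureOne : DefectiveDist where
  weight k := if k = 1 then 1 else 0
  tsum_weight_le_one := by simp

theorem gf_pureOne (s : ℝ≥0∞) : pureOne.gf s = s := by
  unfold gf
  rw [tsum_eq_single 1]
  · simp [pureOne]
  · intro k hk
    simp [pureOne, hk]

theorem tsum_weight_mul_coeff_pow (f g : DefectiveDist) (s : ℝ≥0∞) :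
    ∑' k, (∑' j, f.weight j * PowerSeries.coeff k (PowerSeries.mk g.weight ^ j)) * s ^ k =
      f.gf (g.gf s) := by
  have h : g.gf s = (PowerSeries.mk g.weight).ennrealEval s := by
    simp [gf, PowerSeries.ennrealEval]
  simp_rw [← ENNReal.tsum_mul_right]
  rw [ENNReal.tsum_comm, h]
  unfold gf
  refine tsum_congr fun j => ?_
  rw [← PowerSeries.ennrealEval_pow, PowerSeries.ennrealEval, ← ENNReal.tsum_mul_left]
  exact tsum_congr fun k => mul_assoc _ _ _

/-- The distribution whose generating function is the composition of those of `f` and `g`. -/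
noncomputable def comp (f g : DefectiveDist) : DefectiveDist where
  weight k := ∑' j, f.weight j * PowerSeries.coeff k (PowerSeries.mk g.weight ^ j)
  tsum_weight_le_one := by
    have h := tsum_weight_mul_coeff_pow f g 1
    simp only [one_pow, mul_one] at h
    rw [h]
    exact f.gf_le_one (g.gf_le_one le_rfl)

theorem gf_comp (f g : DefectiveDist) (s : ℝ≥0∞) : (f.comp g).gf s = f.gf (g.gf s) :=
  tsum_weight_mul_coeff_pow f g s

theorem comp_weight_one (f g : DefectiveDist) :
    (f.comp g).weight 1 = ∑' j : ℕ, f.weight j * (j * g.weight 0 ^ (j - 1)) * g.weight 1 := by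
  refine tsum_congr fun j => ?_
  rw [PowerSeries.coeff_one_pow]
  simp only [PowerSeries.coeff_mk, ← PowerSeries.coeff_zero_eq_constantCoeff_apply]
  ring

theorem weight_add_le_gf (f : DefectiveDist) (s : ℝ≥0∞) :
    f.weight 0 + f.weight 1 * s ≤ f.gf s := by
  have := ENNReal.sum_le_tsum (f := fun k => f.weight k * s ^ k) {0, 1}
  simpa [gf] using this

/-- Since `s ≤ 1`, the terms of degree at least two contribute at most `(1 - f[1]) s ^ 2`; the
subtraction is moved to the left side. -/
theorem gf_add_le (f : DefectiveDist) {s : ℝ≥0∞} (hs : s ≤ 1) :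
    f.gf s + f.weight 1 * s ^ 2 ≤ f.weight 0 + f.weight 1 * s + s ^ 2 := by
  have h1 : f.gf s = f.weight 0 + (f.weight 1 * s + ∑' k, f.weight (k + 2) * s ^ (k + 2)) := by
    unfold gf
    rw [tsum_eq_zero_add' ENNReal.summable, tsum_eq_zero_add' ENNReal.summable]
    simp
  have h2 : ∑' k, f.weight (k + 2) * s ^ (k + 2) ≤ (∑' k, f.weight (k + 2)) * s ^ 2 := by
    rw [← ENNReal.tsum_mul_right]
    refine ENNReal.tsum_le_tsum fun k => ?_
    exact mul_le_mul_right (pow_le_pow_right_of_le_one' hs (by omega)) _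
  have h3 : (∑' k, f.weight (k + 2)) + f.weight 1 ≤ 1 := by
    refine le_trans ?_ f.tsum_weight_le_one
    rw [tsum_eq_zero_add' (f := f.weight) ENNReal.summable, tsum_eq_zero_add' (f := fun k => f.weight (k + 1)) ENNReal.summable]
    simp only [zero_add, add_assoc]
    rw [add_comm]
    exact le_add_self
  calc f.gf s + f.weight 1 * s ^ 2
      = f.weight 0 + f.weight 1 * s + (∑' k, f.weight (k + 2) * s ^ (k + 2) + f.weight 1 * s ^ 2) := by
        rw [h1]; ring
    _ ≤ f.weight 0 + f.weight 1 * s + ((∑' k, f.weight (k + 2)) * s ^ 2 + f.weight 1 * s ^ 2) := by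
        gcongr
    _ = f.weight 0 + f.weight 1 * s + ((∑' k, f.weight (k + 2)) + f.weight 1) * s ^ 2 := by ring
    _ ≤ f.weight 0 + f.weight 1 * s + 1 * s ^ 2 := by gcongr
    _ = _ := by rw [one_mul]

theorem weight_ne_top (f : DefectiveDist) (k : ℕ) : f.weight k ≠ ∞ :=
  ne_top_of_le_ne_top ENNReal.one_ne_top (f.weight_le_one k)

/-- The weights determine the mass at `1` through the generating function on `[0, 1]`. -/
theorem weight_one_eq_of_gf_eq {f g : DefectiveDist} (h : ∀ s ≤ 1, f.gf s = g.gf s) :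
    f.weight 1 = g.weight 1 := by
  have key : ∀ {f g : DefectiveDist}, (∀ s ≤ 1, f.gf s = g.gf s) →
      (f.weight 1).toReal ≤ (g.weight 1).toReal := by
    intro f g h
    have h0 : f.weight 0 = g.weight 0 := by rw [← gf_zero, ← gf_zero, h 0 zero_le_one]
    refine le_of_forall_pos_le_add fun ε hε => ?_
    set t := min ε 1 with ht
    have ht0 : 0 < t := lt_min hε one_pos
    have hs : ENNReal.ofReal t ≤ 1 := by simp [ht]
    -- Comparing the affine lower bound for `f` with the quadratic upper bound for `g` at a small
    -- `t` and dividing by `t` leaves an error of at most `t ≤ ε`.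
    have h2 := (f.weight_add_le_gf (ENNReal.ofReal t)).trans (h _ hs).le
    have h3 := (add_le_add_left h2 _).trans (g.gf_add_le hs)
    rw [h0] at h3
    have h4 := ENNReal.toReal_mono (by finiteness [g.weight_ne_top 0, g.weight_ne_top 1]) h3
    have n0 := g.weight_ne_top 0
    have n1 := g.weight_ne_top 1
    have n2 := f.weight_ne_top 1
    rw [ENNReal.toReal_add (by finiteness) (by finiteness),
      ENNReal.toReal_add (by finiteness) (by finiteness),
      ENNReal.toReal_add (by finiteness) (by finiteness),
      ENNReal.toReal_add (by finiteness) (by finiteness)] at h4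
    simp only [ENNReal.toReal_mul, ENNReal.toReal_pow, ENNReal.toReal_ofReal ht0.le] at h4
    have h5 : (f.weight 1).toReal * t ≤ ((g.weight 1).toReal + t) * t := by
      nlinarith [mul_nonneg (ENNReal.toReal_nonneg (a := g.weight 1)) (sq_nonneg t)]
    have h6 := le_of_mul_le_mul_right h5 ht0
    exact h6.trans (by gcongr; exact min_le_left _ _)
  exact (ENNReal.toReal_eq_toReal_iff' (f.weight_ne_top 1) (g.weight_ne_top 1)).1
    (le_antisymm (key h) (key fun s hs => (h s hs).symm))

/-! ### Bounds for the mass at `1` of a composition. -/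

/-- Let `p₀, p₁, p₂` be the probabilities of `0, 1, 2` successes in `k + 2` trials with success
probability `1 - x`. Then `p₀ + p₁ + p₂ ≤ 1`, and completing a square gives `p₁ ≤ p₀ + p₂`. -/
theorem two_mul_nat_mul_pow_mul_le {x : ℝ} (hx0 : 0 ≤ x) (hx1 : x ≤ 1) (k : ℕ) :
    2 * ((k + 2 : ℕ) * x ^ (k + 1) * (1 - x)) ≤ 1 := by
  have key : ∀ k : ℕ, x ^ (k + 2) + (k + 2) * x ^ (k + 1) * (1 - x) +
      (k + 2) * (k + 1) / 2 * x ^ k * (1 - x) ^ 2 ≤ 1 := by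
    intro k
    induction k with
    | zero => norm_num; nlinarith
    | succ k ih =>
      refine le_trans ?_ ih
      have : 0 ≤ (k + 2) * (k + 1) / 2 * x ^ k * (1 - x) ^ 3 := by
        have : 0 ≤ 1 - x := by linarith
        positivity
      push_cast
      have e : x ^ (k + 2) + (k + 2) * x ^ (k + 1) * (1 - x) +
        (k + 2) * (k + 1) / 2 * x ^ k * (1 - x) ^ 2 - (x ^ (k + 1 + 2) + (k + 1 + 2) * x ^ (k + 1 + 1) * (1 - x) +
        (k + 1 + 2) * (k + 1 + 1) / 2 * x ^ (k + 1) * (1 - x) ^ 2) = (k + 2) * (k + 1) / 2 * x ^ k * (1 - x) ^ 3 := by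
        ring
      linarith
  have h := key k
  have h2 : (k + 2) * x ^ (k + 1) * (1 - x) ≤ x ^ (k + 2) + (k + 2) * (k + 1) / 2 * x ^ k * (1 - x) ^ 2 := by
    have : 0 ≤ x ^ k * ((x - (k + 2) / 2 * (1 - x)) ^ 2 + (k + 2) * k / 4 * (1 - x) ^ 2) := by positivity
    have e : x ^ (k + 2) + (k + 2) * (k + 1) / 2 * x ^ k * (1 - x) ^ 2 -
        (k + 2) * x ^ (k + 1) * (1 - x) =
        x ^ k * ((x - (k + 2) / 2 * (1 - x)) ^ 2 + (k + 2) * k / 4 * (1 - x) ^ 2) := by ring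
    linarith
  push_cast
  linarith

theorem nat_mul_pow_le {x : ℝ} (hx0 : 0 ≤ x) (hx1 : x ≤ 1 / 2) (k : ℕ) :
    (k + 2 : ℕ) * x ^ (k + 1) ≤ 2 * x := by
  induction k with
  | zero => norm_num
  | succ k ih =>
    refine le_trans ?_ ih
    have : 0 ≤ x ^ (k + 1) := by positivity
    push_cast
    rw [pow_succ x (k + 1)]
    nlinarith [mul_nonneg (Nat.cast_nonneg (α := ℝ) k) this, mul_le_mul_of_nonneg_left hx1 this]

theorem ennreal_two_mul_mul_pow_le {x y : ℝ≥0∞} (h : x + y ≤ 1) {k : ℕ} (hk : k ≠ 1) :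
    2 * (k * x ^ (k - 1) * y) ≤ 1 := by
  obtain rfl | hk2 : k = 0 ∨ 2 ≤ k := by omega
  · simp
  obtain ⟨k, rfl⟩ := Nat.exists_eq_add_of_le' hk2
  have hx : x ≠ ∞ := ne_top_of_le_ne_top ENNReal.one_ne_top (le_self_add.trans h)
  have hy : y ≠ ∞ := ne_top_of_le_ne_top ENNReal.one_ne_top (le_add_self.trans h)
  have h' := ENNReal.toReal_mono ENNReal.one_ne_top h
  rw [ENNReal.toReal_add hx hy, ENNReal.toReal_one] at h'
  have hy0 := ENNReal.toReal_nonneg (a := y)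
  have key := two_mul_nat_mul_pow_mul_le (ENNReal.toReal_nonneg (a := x)) (by linarith) k
  have h2 : (2 * (((k + 2 : ℕ) : ℝ≥0∞) * x ^ (k + 2 - 1) * y)).toReal ≤ (1 : ℝ≥0∞).toReal := by
    simp only [ENNReal.toReal_mul, ENNReal.toReal_pow, ENNReal.toReal_natCast,
      ENNReal.toReal_ofNat, ENNReal.toReal_one, Nat.add_succ_sub_one]
    refine le_trans ?_ key
    gcongr
    linarith
  exact (ENNReal.toReal_le_toReal (by finiteness) ENNReal.one_ne_top).1 h2

/-- Given `j ≠ 1` individuals after `f`, the chance of having exactly one after `g` is at most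
`1/2`; given `j = 1` it is at most `1`. -/
theorem two_mul_comp_weight_one_le (f g : DefectiveDist) :
    2 * (f.comp g).weight 1 ≤ 1 + f.weight 1 := by
  rw [comp_weight_one, ← ENNReal.tsum_mul_left]
  have h : ∀ j : ℕ, 2 * (f.weight j * (j * g.weight 0 ^ (j - 1)) * g.weight 1) ≤
      f.weight j + if j = 1 then f.weight 1 else 0 := by
    intro j
    by_cases hj : j = 1
    · subst hj
      simp only [Nat.cast_one, tsub_self, pow_zero, mul_one, if_true, ← two_mul]
      gcongr
      exact mul_le_of_le_one_right' (g.weight_le_one 1)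
    · rw [if_neg hj, add_zero]
      calc _ = f.weight j * (2 * (j * g.weight 0 ^ (j - 1) * g.weight 1)) := by ring
        _ ≤ f.weight j * 1 := by
          gcongr
          exact ennreal_two_mul_mul_pow_le g.weight_zero_add_weight_one_le hj
        _ = _ := mul_one _
  refine (ENNReal.tsum_le_tsum h).trans ?_
  rw [ENNReal.tsum_add, tsum_ite_eq]
  gcongr
  exact f.tsum_weight_le_one

theorem comp_weight_one_le (f g : DefectiveDist) (hg : g.weight 0 ≤ 1 / 2) :
    (f.comp g).weight 1 ≤ (f.weight 1 + 2 * g.weight 0) * g.weight 1 := by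
  rw [comp_weight_one, ENNReal.tsum_mul_right]
  gcongr
  have h : ∀ j : ℕ, f.weight j * (j * g.weight 0 ^ (j - 1)) ≤
      (if j = 1 then f.weight 1 else 0) + f.weight j * (2 * g.weight 0) := by
    intro j
    obtain rfl | rfl | hj : j = 0 ∨ j = 1 ∨ 2 ≤ j := by omega
    · simp
    · simp
    · rw [if_neg (by omega), zero_add]
      refine mul_le_mul_right ?_ _
      obtain ⟨k, rfl⟩ := Nat.exists_eq_add_of_le' hj
      have hx := g.weight_ne_top 0
      have h' := ENNReal.toReal_mono (by finiteness) hg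
      have key := nat_mul_pow_le (ENNReal.toReal_nonneg (a := g.weight 0)) (by simpa using h') k
      refine (ENNReal.toReal_le_toReal (by finiteness) (by finiteness)).1 ?_
      simpa only [ENNReal.toReal_mul, ENNReal.toReal_pow, ENNReal.toReal_natCast,
        ENNReal.toReal_ofNat, Nat.add_succ_sub_one] using key
  refine (ENNReal.tsum_le_tsum h).trans ?_
  rw [ENNReal.tsum_add, tsum_ite_eq, ENNReal.tsum_mul_right]
  refine add_le_add_right ?_ _
  exact mul_le_of_le_one_left' f.tsum_weight_le_one

/-! ### Iterated compositions and the summability criterion. -/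

/-- The law of generation `N + r` when generation `N` consists of one individual. -/
noncomputable def iter (f : ℕ → DefectiveDist) (N : ℕ) : ℕ → DefectiveDist
  | 0 => pureOne
  | r + 1 => (iter f N r).comp (f (N + r))

theorem gf_iter_add (f : ℕ → DefectiveDist) (N p q : ℕ) (s : ℝ≥0∞) :
    (iter f N (p + q)).gf s = (iter f N p).gf ((iter f (N + p) q).gf s) := by
  induction q generalizing s with
  | zero => simp [iter, gf_pureOne]
  | succ q ih => rw [← add_assoc, iter, iter, gf_comp, gf_comp, ih, add_assoc]

theorem gf_iter_eq (f : ℕ → DefectiveDist) {s : ℕ → ℝ≥0∞} (hs : ∀ n, (f n).gf (s (n + 1)) = s n)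
    (N r : ℕ) : (iter f N r).gf (s (N + r)) = s N := by
  induction r with
  | zero => simp [iter, gf_pureOne]
  | succ r ih => rw [iter, gf_comp, ← add_assoc, hs, ih]

/-- With `c` and `u` the masses of the iterates at `1` and `0`, the potential `c - 8/3 u` is bounded
and drops by at least `3/4 (1 - y r)` at step `r`, so the drops telescope. -/
theorem summable_of_frequently_iter_weight_one (f : ℕ → DefectiveDist) (N : ℕ)
    (h : ∃ᶠ r in atTop, 7 / 8 ≤ ((iter f N r).weight 1).toReal) :
    ∑' n, (1 - (f n).weight 1) < ∞ := by
  set c : ℕ → ℝ := fun r => ((iter f N r).weight 1).toReal with hc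
  set u : ℕ → ℝ := fun r => ((iter f N r).weight 0).toReal with hu
  set x : ℕ → ℝ := fun r => ((f (N + r)).weight 0).toReal with hx
  set y : ℕ → ℝ := fun r => ((f (N + r)).weight 1).toReal with hy
  -- A later `c ≥ 7/8` forces `2 * 7/8 ≤ 1 + c r`. The composition is associative only through
  -- generating functions, which suffices to identify the mass at `1`.
  have c_ge : ∀ r, 3 / 4 ≤ c r := by
    intro r
    obtain ⟨r', hr', hr⟩ := (h.and_eventually (eventually_ge_atTop r)).exists
    obtain ⟨q, rfl⟩ := Nat.exists_eq_add_of_le hr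
    have e : (iter f N (r + q)).weight 1 = ((iter f N r).comp (iter f (N + r) q)).weight 1 :=
      weight_one_eq_of_gf_eq fun s _ => by rw [gf_iter_add, gf_comp]
    have k := two_mul_comp_weight_one_le (iter f N r) (iter f (N + r) q)
    rw [← e] at k
    have n1 := (iter f N r).weight_ne_top 1
    have k := ENNReal.toReal_mono (by finiteness) k
    rw [ENNReal.toReal_add (by finiteness) n1, ENNReal.toReal_mul, ENNReal.toReal_one,
      ENNReal.toReal_ofNat] at k
    simp only [hc]
    linarith
  have uc : ∀ r, u r + c r ≤ 1 := by
    intro r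
    have k := ENNReal.toReal_mono (by finiteness) (iter f N r).weight_zero_add_weight_one_le
    rwa [ENNReal.toReal_add (weight_ne_top _ _) (weight_ne_top _ _), ENNReal.toReal_one] at k
  have ustep : ∀ r, u r + c r * x r ≤ u (r + 1) := by
    intro r
    have k := (iter f N r).weight_add_le_gf ((f (N + r)).weight 0)
    rw [← gf_zero (f (N + r)), ← gf_comp, gf_zero, gf_zero] at k
    have n0 := (iter f N r).weight_ne_top 0
    have n1 := (iter f N r).weight_ne_top 1
    have n2 := (f (N + r)).weight_ne_top 0
    have k := ENNReal.toReal_mono (weight_ne_top _ _) k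
    rwa [ENNReal.toReal_add n0 (by finiteness), ENNReal.toReal_mul] at k
  have u0 : ∀ r, 0 ≤ u r := fun r => ENNReal.toReal_nonneg
  have x0 : ∀ r, 0 ≤ x r := fun r => ENNReal.toReal_nonneg
  have y0 : ∀ r, 0 ≤ y r := fun r => ENNReal.toReal_nonneg
  have y1 : ∀ r, y r ≤ 1 := fun r => by
    simpa using ENNReal.toReal_mono ENNReal.one_ne_top ((f (N + r)).weight_le_one 1)
  have ux : ∀ r, 3 / 4 * x r ≤ u (r + 1) - u r := by
    intro r
    nlinarith [ustep r, mul_le_mul_of_nonneg_right (c_ge r) (x0 r)]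
  have x_le : ∀ r, x r ≤ 1 / 2 := by
    intro r
    linarith [ux r, u0 r, uc (r + 1), c_ge (r + 1)]
  have cstep : ∀ r, c (r + 1) ≤ (c r + 2 * x r) * y r := by
    intro r
    have hx' : (f (N + r)).weight 0 ≤ 1 / 2 := by
      refine (ENNReal.toReal_le_toReal (weight_ne_top _ _) (by finiteness)).1 ?_
      simpa using x_le r
    have k := comp_weight_one_le (iter f N r) (f (N + r)) hx'
    have n1 := (iter f N r).weight_ne_top 1
    have n2 := (f (N + r)).weight_ne_top 0
    have n3 := (f (N + r)).weight_ne_top 1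
    have k := ENNReal.toReal_mono (by finiteness) k
    rwa [ENNReal.toReal_mul, ENNReal.toReal_add n1 (by finiteness), ENNReal.toReal_mul,
      ENNReal.toReal_ofNat] at k
  -- The loss `2 * x r` in `cstep` is paid by the growth of `u` through `ux`; hence the factor `8/3
  -- = 2 / (3/4)`.
  have step : ∀ r, 3 / 4 * (1 - y r) ≤ (c r - 8 / 3 * u r) - (c (r + 1) - 8 / 3 * u (r + 1)) := by
    intro r
    have h1 := mul_le_mul_of_nonneg_right (c_ge r) (sub_nonneg.2 (y1 r))
    have h2 := mul_le_mul_of_nonneg_left (y1 r) (x0 r)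
    nlinarith [cstep r, ux r]
  have sumY : Summable fun r => 1 - y r := by
    refine summable_of_sum_range_le (c := 6) (fun r => sub_nonneg.2 (y1 r)) fun n => ?_
    have k := Finset.sum_le_sum fun r (_ : r ∈ Finset.range n) => step r
    rw [← Finset.mul_sum, Finset.sum_range_sub'] at k
    linarith [u0 0, u0 n, uc 0, uc n, c_ge n]
  have sumAll : Summable fun n => 1 - ((f n).weight 1).toReal := by
    rw [← summable_nat_add_iff N]
    simpa [hy, add_comm] using sumY
  have e : ∀ n, 1 - (f n).weight 1 = ENNReal.ofReal (1 - ((f n).weight 1).toReal) := by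
    intro n
    rw [ENNReal.ofReal_sub _ ENNReal.toReal_nonneg, ENNReal.ofReal_one,
      ENNReal.ofReal_toReal (weight_ne_top _ _)]
  simp_rw [e]
  exact sumAll.tsum_ofReal_lt_top

/-- If two backward orbits of the generating functions converge along a common subsequence to `0`
and to some `σ ∈ (0, 1)`, then the environment is asymptotically trivial. -/
theorem tsum_lt_top_of_orbits (f : ℕ → DefectiveDist) {s e : ℕ → ℝ≥0∞}
    (hs : ∀ n, (f n).gf (s (n + 1)) = s n) (he : ∀ n, (f n).gf (e (n + 1)) = e n)
    (hs1 : ∀ n, s n ≤ 1) (he1 : ∀ n, e n ≤ 1) {ν : ℕ → ℕ} (hν : StrictMono ν) {σ : ℝ}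
    (hσ0 : 0 < σ) (hσ1 : σ < 1) (hsσ : Tendsto (fun i => (s (ν i)).toReal) atTop (𝓝 σ))
    (he0 : Tendsto (fun i => (e (ν i)).toReal) atTop (𝓝 0)) :
    ∑' n, (1 - (f n).weight 1) < ∞ := by
  set τ := σ * (1 - σ) with hτ
  have hτ0 : 0 < τ := mul_pos hσ0 (by linarith)
  have ev1 := (Metric.tendsto_nhds.1 hsσ) (τ / 64) (by positivity)
  have ev2 := (Metric.tendsto_nhds.1 he0) (τ / 64) (by positivity)
  obtain ⟨I, hI⟩ := eventually_atTop.1 (ev1.and ev2)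
  refine summable_of_frequently_iter_weight_one f (ν I) ?_
  rw [frequently_atTop]
  intro R
  obtain ⟨j, hj1, hj2⟩ : ∃ j, I ≤ j ∧ ν I + R ≤ ν j :=
    ⟨I + (ν I + R), by omega, le_trans (by omega) (hν.le_apply (x := I + (ν I + R)))⟩
  obtain ⟨r, hr⟩ := Nat.exists_eq_add_of_le (le_trans (Nat.le_add_right _ R) hj2)
  refine ⟨r, by omega, ?_⟩
  set K := iter f (ν I) r with hK
  have ks : K.gf (s (ν j)) = s (ν I) := by rw [hr]; exact gf_iter_eq f hs _ _
  have ke : K.weight 0 ≤ e (ν I) := by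
    rw [← gf_zero, ← gf_iter_eq f he (ν I) r]
    exact K.gf_mono zero_le
  have k := K.gf_add_le (hs1 (ν j))
  rw [ks] at k
  have k := k.trans (add_le_add_left (add_le_add_left ke _) _)
  have n1 := K.weight_ne_top 1
  have ns : ∀ n, s n ≠ ∞ := fun n => ne_top_of_le_ne_top ENNReal.one_ne_top (hs1 n)
  have ne : ∀ n, e n ≠ ∞ := fun n => ne_top_of_le_ne_top ENNReal.one_ne_top (he1 n)
  have nsi := ns (ν I)
  have nsj := ns (ν j)
  have nei := ne (ν I)
  have k := ENNReal.toReal_mono (by finiteness) k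
  rw [ENNReal.toReal_add (by finiteness) (by finiteness),
    ENNReal.toReal_add (by finiteness) (by finiteness),
    ENNReal.toReal_add (by finiteness) (by finiteness)] at k
  simp only [ENNReal.toReal_mul, ENNReal.toReal_pow] at k
  obtain ⟨hsI, heI⟩ := hI I le_rfl
  obtain ⟨hsj, -⟩ := hI j hj1
  rw [Real.dist_eq, abs_lt] at hsI hsj heI
  have b1 : (s (ν j)).toReal ≤ 1 := by simpa using ENNReal.toReal_mono ENNReal.one_ne_top (hs1 (ν j))
  have b0 : 0 ≤ (s (ν j)).toReal := ENNReal.toReal_nonneg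
  set a := (s (ν j)).toReal
  set b := (s (ν I)).toReal
  set d := (e (ν I)).toReal
  -- `a (1 - a) - σ (1 - σ) = (a - σ) (1 - a - σ)`, whose second factor is at most `1` in absolute
  -- value.
  have ha : τ - τ / 64 ≤ a * (1 - a) := by
    have : |(a - σ) * (1 - a - σ)| ≤ τ / 64 * 1 := by
      rw [abs_mul]
      exact mul_le_mul (abs_le.2 ⟨hsj.1.le, hsj.2.le⟩) (abs_le.2 ⟨by linarith, by linarith⟩)
        (abs_nonneg _) (by positivity)
    have := (abs_le.1 this).1
    nlinarith
  have ha0 : 0 < a * (1 - a) := by linarith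
  -- `k` gives `K[1] a (1 - a) ≥ a (1 - a) - (a - b) - d`, and the errors total at most `3τ/64`, far
  -- below an eighth of `a (1 - a)`.
  have : 7 / 8 * (a * (1 - a)) ≤ (K.weight 1).toReal * (a * (1 - a)) := by nlinarith
  exact le_of_mul_le_mul_right this ha0

/-! ### Backward orbits of the generating functions. -/

theorem gf_le_weight_zero_add (f : DefectiveDist) {s : ℝ≥0∞} (hs : s ≤ 1) :
    f.gf s ≤ f.weight 0 + s := by
  have h : ∀ k, f.weight k * s ^ k ≤ (if k = 0 then f.weight 0 else 0) + f.weight k * s := by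
    intro k
    obtain rfl | hk := Nat.eq_zero_or_pos k
    · simp
    · rw [if_neg hk.ne', zero_add]
      exact mul_le_mul_right (pow_le_of_le_one zero_le hs hk.ne') _
  refine (ENNReal.tsum_le_tsum h).trans ?_
  rw [ENNReal.tsum_add, tsum_ite_eq, ENNReal.tsum_mul_right]
  exact add_le_add_right (mul_le_of_le_one_left' f.tsum_weight_le_one) _

theorem exists_weight_pos (f : DefectiveDist) (hf : 0 < f.derivOne) :
    ∃ k, 0 < k ∧ 0 < f.weight k := by
  by_contra! h
  refine hf.ne' (ENNReal.tsum_eq_zero.2 fun k => ?_)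
  obtain rfl | hk := Nat.eq_zero_or_pos k
  · simp
  · rw [nonpos_iff_eq_zero.1 (h k hk), mul_zero]

theorem gf_strictMonoOn (f : DefectiveDist) (hf : 0 < f.derivOne) :
    StrictMonoOn f.gf (Set.Iic 1) := by
  intro s hs t ht hst
  obtain ⟨k, hk, hfk⟩ := f.exists_weight_pos hf
  refine ENNReal.tsum_lt_tsum (i := k)
    (ne_top_of_le_ne_top ENNReal.one_ne_top (f.gf_le_one hs)) (fun i => by gcongr) ?_
  exact ENNReal.mul_lt_mul_right hfk.ne' (f.weight_ne_top k)
    (ENNReal.pow_lt_pow_left hk.ne' hst)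

theorem exists_gf_eq (f : DefectiveDist) {t : ℝ≥0∞} (h0 : f.gf 0 ≤ t) (h1 : t ≤ f.gf 1) :
    ∃ s ≤ 1, f.gf s = t := by
  have ht : t ≠ ∞ := ne_top_of_le_ne_top ENNReal.one_ne_top (h1.trans (f.gf_le_one le_rfl))
  have hsum : Summable fun k => (f.weight k).toReal :=
    ENNReal.summable_toReal (ne_top_of_le_ne_top ENNReal.one_ne_top f.tsum_weight_le_one)
  have hreal : ∀ x : ℝ, 0 ≤ x →
      (f.gf (ENNReal.ofReal x)).toReal = ∑' k, (f.weight k).toReal * x ^ k := by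
    intro x hx
    unfold gf
    rw [ENNReal.tsum_toReal_eq fun k => by finiteness [f.weight_ne_top k]]
    refine tsum_congr fun k => ?_
    rw [ENNReal.toReal_mul, ENNReal.toReal_pow, ENNReal.toReal_ofReal hx]
  have hcont : ContinuousOn (fun x : ℝ => (f.gf (ENNReal.ofReal x)).toReal) (Set.Icc 0 1) := by
    have : ContinuousOn (fun x : ℝ => ∑' k, (f.weight k).toReal * x ^ k) (Set.Icc 0 1) := by
      refine continuousOn_tsum (u := fun k => (f.weight k).toReal) (fun k => by fun_prop) hsum ?_
      intro k x hx
      rw [Real.norm_of_nonneg (mul_nonneg ENNReal.toReal_nonneg (pow_nonneg hx.1 _))]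
      exact mul_le_of_le_one_right ENNReal.toReal_nonneg (pow_le_one₀ hx.1 hx.2)
    exact this.congr fun x hx => hreal x hx.1
  have key := intermediate_value_Icc zero_le_one hcont
  have hmem : t.toReal ∈ Set.Icc (f.gf (ENNReal.ofReal 0)).toReal (f.gf (ENNReal.ofReal 1)).toReal := by
    rw [ENNReal.ofReal_zero, ENNReal.ofReal_one]
    exact ⟨ENNReal.toReal_mono ht h0,
      ENNReal.toReal_mono (ne_top_of_le_ne_top ENNReal.one_ne_top (f.gf_le_one le_rfl)) h1⟩
  obtain ⟨x, hx, hxt⟩ := key hmem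
  have hx1 : ENNReal.ofReal x ≤ 1 := by simpa using hx.2
  exact ⟨ENNReal.ofReal x, hx1, (ENNReal.toReal_eq_toReal_iff'
    (ne_top_of_le_ne_top ENNReal.one_ne_top (f.gf_le_one hx1)) ht).1 hxt⟩

theorem gf_iter_injOn (f : ℕ → DefectiveDist) (hf : ∀ n, 0 < (f n).derivOne) (n : ℕ) :
    Set.InjOn (iter f 0 n).gf (Set.Iic 1) := by
  induction n with
  | zero =>
    intro s _ t _ h
    simpa [iter, gf_pureOne] using h
  | succ n ih =>
    intro s hs t ht h
    simp only [iter, gf_comp, zero_add] at h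
    exact ((f n).gf_strictMonoOn (hf n)).injOn hs ht
      (ih ((f n).gf_le_one hs) ((f n).gf_le_one ht) h)

/-- Existence of backward orbits of the generating functions with a prescribed starting point. -/
theorem exists_orbit (f : ℕ → DefectiveDist) (hf : ∀ n, 0 < (f n).derivOne) {t : ℝ≥0∞}
    (h0 : ∀ n, (iter f 0 n).gf 0 ≤ t) (h1 : ∀ n, t ≤ (iter f 0 n).gf 1) :
    ∃ s : ℕ → ℝ≥0∞, s 0 = t ∧ (∀ n, s n ≤ 1) ∧ ∀ n, (f n).gf (s (n + 1)) = s n := by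
  -- Each `s n` is a preimage of `t` under the whole `n`-fold iterate; injectivity of the iterates
  -- then yields the one-step relation.
  choose s hs1 hst using fun n => (iter f 0 n).exists_gf_eq (h0 n) (h1 n)
  refine ⟨s, by simpa [iter, gf_pureOne] using hst 0, hs1, fun n => ?_⟩
  refine gf_iter_injOn f hf n ((f n).gf_le_one (hs1 _)) (hs1 n) ?_
  rw [hst n, ← hst (n + 1)]
  simp only [iter, gf_comp, zero_add]

end DefectiveDist

/-! ### Powers with exponent in `ℕ₀ ∪ {Δ}` and measurability. -/

namespace DeltaNat

/-- `s ^ z`, with the convention `s ^ Δ = 0`. -/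
noncomputable def powEval (s : ℝ≥0∞) : DeltaNat → ℝ≥0∞
  | nat k => s ^ k
  | delta => 0

@[simp] theorem powEval_nat (s : ℝ≥0∞) (k : ℕ) : powEval s (nat k) = s ^ k := rfl

@[simp] theorem powEval_delta (s : ℝ≥0∞) : powEval s delta = 0 := rfl

theorem powEval_add (s : ℝ≥0∞) (x y : DeltaNat) :
    powEval s (x + y) = powEval s x * powEval s y := by
  cases x <;> cases y <;> simp [pow_add]

theorem powEval_sum (s : ℝ≥0∞) (x : ℕ → DeltaNat) (m : ℕ) :
    powEval s (∑ j ∈ Finset.range m, x j) = ∏ j ∈ Finset.range m, powEval s (x j) := by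
  induction m with
  | zero => simp [zero_def]
  | succ m ih => rw [Finset.sum_range_succ, Finset.prod_range_succ, powEval_add, ih]

theorem powEval_le_one {s : ℝ≥0∞} (hs : s ≤ 1) (z : DeltaNat) : powEval s z ≤ 1 := by
  cases z with
  | nat k => exact pow_le_one' hs k
  | delta => exact zero_le

instance : Countable DeltaNat :=
  Function.Injective.countable (f := fun z : DeltaNat => match z with
    | nat k => some k
    | delta => none) (by
      intro a b h
      cases a <;> cases b <;> simp_all)

instance : DiscreteMeasurableSpace DeltaNat := ⟨fun _ => trivial⟩

instance : MeasurableAdd₂ DeltaNat := ⟨Measurable.of_discrete⟩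

theorem measurable_powEval (s : ℝ≥0∞) : Measurable (powEval s) := Measurable.of_discrete

theorem measurable_deltaSum {Ω : Type*} {mΩ : MeasurableSpace Ω} {x : ℕ → Ω → DeltaNat}
    (hx : ∀ j, Measurable (x j)) {z : Ω → DeltaNat} (hz : Measurable z) :
    Measurable fun ω => deltaSum (fun j => x j ω) (z ω) := by
  have h : ∀ w, Measurable fun ω => deltaSum (fun j => x j ω) w := by
    intro w
    cases w with
    | nat m => exact Finset.measurable_fun_sum _ fun j _ => hx j
    | delta => exact measurable_const
  refine measurable_to_countable' fun y => ?_
  have e : (fun ω => deltaSum (fun j => x j ω) (z ω)) ⁻¹' {y} =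
      ⋃ w, z ⁻¹' {w} ∩ (fun ω => deltaSum (fun j => x j ω) w) ⁻¹' {y} := by
    ext ω
    simp
  rw [e]
  exact MeasurableSet.iUnion fun w => (hz (measurableSet_singleton w)).inter
    (h w (measurableSet_singleton y))

end DeltaNat

open DeltaNat

/-! ### Independence of generations and the martingale of an orbit. -/

section

variable {Ω : Type*} {f : ℕ → DefectiveDist}
  {X : ℕ → ℕ → Ω → DeltaNat} {Z : ℕ → Ω → DeltaNat}

/-- The `σ`-algebra generated by the contributions of the individuals `p ∈ S`. -/
@[reducible] def offspringSigma (X : ℕ → ℕ → Ω → DeltaNat) (S : Set (ℕ × ℕ)) : MeasurableSpace Ω :=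
  ⨆ p ∈ S, MeasurableSpace.comap (X p.1 p.2) inferInstance

theorem measurable_offspringSigma {S : Set (ℕ × ℕ)} {n j : ℕ} (h : (n, j) ∈ S) :
    Measurable[offspringSigma X S] (X n j) :=
  measurable_iff_comap_le.2 (le_iSup₂_of_le (n, j) h le_rfl)

theorem offspringSigma_mono {S T : Set (ℕ × ℕ)} (h : S ⊆ T) :
    offspringSigma X S ≤ offspringSigma X T :=
  biSup_mono fun _ hp => h hp

/-- The individuals of the generations before `n`. -/
abbrev pastIndices (n : ℕ) : Set (ℕ × ℕ) := {p | p.1 < n}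

/-- The individuals of the generations from `n` on. -/
abbrev futureIndices (n : ℕ) : Set (ℕ × ℕ) := {p | n ≤ p.1}

theorem disjoint_past_future (n : ℕ) : Disjoint (pastIndices n) (futureIndices n) :=
  Set.disjoint_left.2 fun _ h1 h2 => not_lt.2 (Set.mem_ofPred.1 h2) h1

theorem measurable_past (h0 : ∀ ω, Z 0 ω = .nat 1)
    (hZ : ∀ n ω, Z (n + 1) ω = deltaSum (fun j => X n j ω) (Z n ω)) (n : ℕ) :
    Measurable[offspringSigma X (pastIndices n)] (Z n) := by
  induction n with
  | zero =>
    have : Z 0 = fun _ => .nat 1 := funext h0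
    rw [this]
    exact measurable_const
  | succ n ih =>
    have : Z (n + 1) = fun ω => deltaSum (fun j => X n j ω) (Z n ω) := funext (hZ n)
    rw [this]
    refine measurable_deltaSum (fun j => measurable_offspringSigma (by simp)) ?_
    exact ih.mono (offspringSigma_mono fun p hp => Nat.lt_succ_of_lt hp) le_rfl

variable [mΩ : MeasurableSpace Ω] {P : Measure Ω}

theorem IsOffspringFamily.sigma_le (hX : IsOffspringFamily P f X) (S : Set (ℕ × ℕ)) :
    offspringSigma X S ≤ mΩ :=
  iSup₂_le fun p _ => measurable_iff_comap_le.1 (hX.measurable p.1 p.2)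

theorem IsOffspringFamily.indep_sigma (hX : IsOffspringFamily P f X) {S T : Set (ℕ × ℕ)}
    (h : Disjoint S T) : Indep (offspringSigma X S) (offspringSigma X T) P :=
  indep_iSup_of_disjoint
    (m := fun p : ℕ × ℕ => MeasurableSpace.comap (X p.1 p.2) inferInstance)
    (fun p => measurable_iff_comap_le.1 (hX.measurable p.1 p.2)) hX.indep.iIndep h

theorem IsOffspringFamily.lintegral_powEval (hX : IsOffspringFamily P f X) (n j : ℕ)
    (s : ℝ≥0∞) : ∫⁻ ω, powEval s (X n j ω) ∂P = (f n).gf s := by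
  have e : ∀ ω, powEval s (X n j ω) =
      ∑' k, {ω | X n j ω = .nat k}.indicator (fun _ => s ^ k) ω := by
    intro ω
    cases h : X n j ω with
    | nat k =>
      rw [tsum_eq_single k]
      · simp [h]
      · intro i hi
        simp [h, hi.symm]
    | delta => simp [h]
  have hm : ∀ k, MeasurableSet {ω | X n j ω = .nat k} := fun k =>
    hX.measurable n j (measurableSet_singleton _)
  simp_rw [e]
  rw [lintegral_tsum fun k => (measurable_const.indicator (hm k)).aemeasurable]
  refine tsum_congr fun k => ?_
  rw [lintegral_indicator_const (hm k), hX.law, mul_comm]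

theorem IsOffspringFamily.lintegral_prod_powEval (hX : IsOffspringFamily P f X) (n m : ℕ)
    (s : ℝ≥0∞) :
    ∫⁻ ω, ∏ j ∈ Finset.range m, powEval s (X n j ω) ∂P = (f n).gf s ^ m := by
  have hind : iIndepFun (fun j ω => powEval s (X n j ω)) P :=
    (hX.indep.precomp (g := fun j : ℕ => (n, j)) fun a b h => by simpa using h).comp
      (fun _ => powEval s) fun _ => measurable_powEval s
  rw [lintegral_prod_eq_prod_lintegral_of_indepFun _ _ hind
    fun j => (measurable_powEval s).comp (hX.measurable n j)]
  simp [hX.lintegral_powEval]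

/-- On `Z n = k` the power splits into `k` independent factors of mean `f n (s)`, independent of the
past event `B`. With `f n (s (n+1)) = s n` this is the martingale property. -/
theorem IsOffspringFamily.setLIntegral_powEval_succ (hX : IsOffspringFamily P f X)
    (h0 : ∀ ω, Z 0 ω = .nat 1)
    (hZ : ∀ n ω, Z (n + 1) ω = deltaSum (fun j => X n j ω) (Z n ω)) (n : ℕ) (s : ℝ≥0∞)
    {B : Set Ω} (hB : MeasurableSet[offspringSigma X (pastIndices n)] B) :
    ∫⁻ ω in B, powEval s (Z (n + 1) ω) ∂P = ∫⁻ ω in B, powEval ((f n).gf s) (Z n ω) ∂P := by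
  set C : ℕ → Set Ω := fun k => B ∩ {ω | Z n ω = .nat k} with hC
  have hCp : ∀ k, MeasurableSet[offspringSigma X (pastIndices n)] (C k) := fun k =>
    hB.inter (measurable_past h0 hZ n (measurableSet_singleton _))
  have hCm : ∀ k, MeasurableSet (C k) := fun k => hX.sigma_le _ _ (hCp k)
  have hBm : MeasurableSet B := hX.sigma_le _ _ hB
  have e1 : ∀ ω, B.indicator (fun ω => powEval s (Z (n + 1) ω)) ω =
      ∑' k, (C k).indicator (fun _ => 1) ω * ∏ j ∈ Finset.range k, powEval s (X n j ω) := by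
    intro ω
    by_cases hω : ω ∈ B
    · rw [Set.indicator_of_mem hω, hZ]
      cases h : Z n ω with
      | nat k =>
        rw [tsum_eq_single k]
        · simp [hC, hω, h, deltaSum, powEval_sum]
        · intro i hi
          simp [hC, h, hi.symm]
      | delta => simp [hC, h, deltaSum]
    · simp [hC, hω]
  have e2 : ∀ ω, B.indicator (fun ω => powEval ((f n).gf s) (Z n ω)) ω =
      ∑' k, (C k).indicator (fun _ => (f n).gf s ^ k) ω := by
    intro ω
    by_cases hω : ω ∈ B
    · rw [Set.indicator_of_mem hω]
      cases h : Z n ω with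
      | nat k =>
        rw [tsum_eq_single k]
        · simp [hC, hω, h]
        · intro i hi
          simp [hC, h, hi.symm]
      | delta => simp [hC, h]
    · simp [hC, hω]
  rw [← lintegral_indicator hBm, ← lintegral_indicator hBm]
  simp_rw [e1, e2]
  have hprod : ∀ k, Measurable[offspringSigma X (futureIndices n)]
      fun ω => ∏ j ∈ Finset.range k, powEval s (X n j ω) := fun k =>
    Finset.measurable_fun_prod _ fun j _ =>
      (measurable_powEval s).comp (measurable_offspringSigma (Set.mem_ofPred.2 le_rfl))
  rw [lintegral_tsum fun k => ((measurable_const.indicator (hCm k)).fun_mul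
      ((hprod k).mono (hX.sigma_le _) le_rfl)).aemeasurable,
    lintegral_tsum fun k => (measurable_const.indicator (hCm k)).aemeasurable]
  refine tsum_congr fun k => ?_
  rw [lintegral_mul_eq_lintegral_mul_lintegral_of_independent_measurableSpace
    (hX.sigma_le _) (hX.sigma_le _) (hX.indep_sigma (disjoint_past_future n))
    (measurable_const.indicator (hCp k)) (hprod k), hX.lintegral_prod_powEval,
    lintegral_indicator_const (hCm k), lintegral_indicator_const (hCm k), one_mul, mul_comm]

theorem IsOffspringFamily.lintegral_powEval_process [IsProbabilityMeasure P]
    (hX : IsOffspringFamily P f X) (h0 : ∀ ω, Z 0 ω = .nat 1)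
    (hZ : ∀ n ω, Z (n + 1) ω = deltaSum (fun j => X n j ω) (Z n ω)) (n : ℕ) (s : ℝ≥0∞) :
    ∫⁻ ω, powEval s (Z n ω) ∂P = (DefectiveDist.iter f 0 n).gf s := by
  induction n generalizing s with
  | zero => simp [h0, DefectiveDist.iter, DefectiveDist.gf_pureOne]
  | succ n ih =>
    have h := hX.setLIntegral_powEval_succ h0 hZ n s (B := Set.univ) MeasurableSet.univ
    simp only [Measure.restrict_univ] at h
    rw [h, ih, DefectiveDist.iter, DefectiveDist.gf_comp, zero_add]

/-- The filtration of the generations. -/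
def IsOffspringFamily.filtration (hX : IsOffspringFamily P f X) : Filtration ℕ mΩ where
  seq n := offspringSigma X (pastIndices n)
  mono' _ _ h := offspringSigma_mono fun _ hp => lt_of_lt_of_le hp h
  le' _ := hX.sigma_le _

theorem IsOffspringFamily.measurable_process (hX : IsOffspringFamily P f X)
    (h0 : ∀ ω, Z 0 ω = .nat 1)
    (hZ : ∀ n ω, Z (n + 1) ω = deltaSum (fun j => X n j ω) (Z n ω)) (n : ℕ) :
    Measurable (Z n) :=
  (measurable_past h0 hZ n).mono (hX.sigma_le _) le_rfl

/-- For a backward orbit `s` of the generating functions, `s n ^ Z n` is a bounded martingale. -/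
theorem IsOffspringFamily.exists_limit [IsProbabilityMeasure P]
    (hX : IsOffspringFamily P f X) (h0 : ∀ ω, Z 0 ω = .nat 1)
    (hZ : ∀ n ω, Z (n + 1) ω = deltaSum (fun j => X n j ω) (Z n ω)) {s : ℕ → ℝ≥0∞}
    (hs1 : ∀ n, s n ≤ 1) (hs : ∀ n, (f n).gf (s (n + 1)) = s n) :
    ∃ W : Ω → ℝ, Integrable W P ∧ (∀ᵐ ω ∂P, 0 ≤ W ω) ∧ ∫ ω, W ω ∂P = (s 0).toReal ∧
      ∀ᵐ ω ∂P, Tendsto (fun n => (powEval (s n) (Z n ω)).toReal) atTop (𝓝 (W ω)) := by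
  set M : ℕ → Ω → ℝ := fun n ω => (powEval (s n) (Z n ω)).toReal with hM
  have hmeasE : ∀ n, Measurable fun ω => powEval (s n) (Z n ω) := fun n =>
    (measurable_powEval _).comp (hX.measurable_process h0 hZ n)
  have hmeas : ∀ n, Measurable (M n) := fun n => (hmeasE n).ennreal_toReal
  have hle : ∀ n ω, powEval (s n) (Z n ω) ≤ 1 := fun n ω => powEval_le_one (hs1 n) _
  have hM0 : ∀ n ω, 0 ≤ M n ω := fun n ω => ENNReal.toReal_nonneg
  have hM1 : ∀ n ω, M n ω ≤ 1 := fun n ω => by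
    simpa using ENNReal.toReal_mono ENNReal.one_ne_top (hle n ω)
  have hbd : ∀ n ω, ‖M n ω‖ ≤ 1 := fun n ω => by
    rw [Real.norm_of_nonneg (hM0 n ω)]
    exact hM1 n ω
  have hint : ∀ n, Integrable (M n) P := fun n =>
    Integrable.of_bound (hmeas n).aestronglyMeasurable 1 (Eventually.of_forall (hbd n))
  have hmart : Martingale M hX.filtration P := by
    refine martingale_of_setIntegral_eq_succ (fun n => ?_) hint fun n B hB => ?_
    · have : Measurable[offspringSigma X (pastIndices n)] (M n) :=
        (Measurable.of_discrete (f := fun z => (powEval (s n) z).toReal)).comp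
          (measurable_past h0 hZ n)
      exact this.stronglyMeasurable
    · have hfin : ∀ n, ∀ᵐ ω ∂P.restrict B, powEval (s n) (Z n ω) < ∞ := fun n =>
        Eventually.of_forall fun ω => (hle n ω).trans_lt ENNReal.one_lt_top
      rw [integral_toReal (hmeasE n).aemeasurable (hfin n),
        integral_toReal (hmeasE (n + 1)).aemeasurable (hfin (n + 1)),
        hX.setLIntegral_powEval_succ h0 hZ n _ hB, hs]
  have hconv : ∀ᵐ ω ∂P, ∃ c, Tendsto (fun n => M n ω) atTop (𝓝 c) := by
    refine hmart.submartingale.exists_ae_tendsto_of_bdd (R := 1) fun n => ?_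
    refine (eLpNorm_le_of_ae_bound (C := 1) (Eventually.of_forall (hbd n))).trans ?_
    simp
  obtain ⟨W, hW⟩ := hconv.choice
  have hWm : AEStronglyMeasurable W P :=
    (aemeasurable_of_tendsto_metrizable_ae atTop (fun n => (hmeas n).aemeasurable)
      hW).aestronglyMeasurable
  have hW0 : ∀ᵐ ω ∂P, 0 ≤ W ω := hW.mono fun ω h => ge_of_tendsto' h fun n => hM0 n ω
  have hWi : Integrable W P := Integrable.of_bound hWm 1 <| by
    filter_upwards [hW, hW0] with ω h h0
    rw [Real.norm_of_nonneg h0]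
    exact le_of_tendsto' h fun n => hM1 n ω
  refine ⟨W, hWi, hW0, ?_, hW⟩
  have hlim := tendsto_integral_of_dominated_convergence (fun _ => (1 : ℝ))
    (fun n => (hmeas n).aestronglyMeasurable) (integrable_const _)
    (fun n => Eventually.of_forall (hbd n)) hW
  have hconst : ∀ n, ∫ ω, M n ω ∂P = (s 0).toReal := by
    intro n
    rw [integral_toReal (hmeasE n).aemeasurable
      (Eventually.of_forall fun ω => (hle n ω).trans_lt ENNReal.one_lt_top),
      hX.lintegral_powEval_process h0 hZ]
    have := DefectiveDist.gf_iter_eq f hs 0 n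
    rw [zero_add] at this
    rw [this]
  simp_rw [hconst] at hlim
  exact tendsto_nhds_unique hlim tendsto_const_nhds |>.symm ▸ rfl

end

/-! ### Infinitely many visits to a positive state force summability. -/

section

variable {Ω : Type*} {f : ℕ → DefectiveDist} {X : ℕ → ℕ → Ω → DeltaNat} {Z : ℕ → Ω → DeltaNat}

theorem process_eq_zero_of_le
    (hZ : ∀ n ω, Z (n + 1) ω = deltaSum (fun j => X n j ω) (Z n ω)) {ω : Ω} {n k : ℕ}
    (h : Z n ω = .nat 0) (hnk : n ≤ k) : Z k ω = .nat 0 := by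
  induction k, hnk using Nat.le_induction with
  | base => exact h
  | succ k _ ih => simp [hZ, ih, deltaSum, zero_def]

theorem process_eq_delta_of_le
    (hZ : ∀ n ω, Z (n + 1) ω = deltaSum (fun j => X n j ω) (Z n ω)) {ω : Ω} {n k : ℕ}
    (h : Z n ω = .delta) (hnk : n ≤ k) : Z k ω = .delta := by
  induction k, hnk using Nat.le_induction with
  | base => exact h
  | succ k _ ih => simp [hZ, ih, deltaSum]

theorem sum_range_nat_one {x : ℕ → DeltaNat} {m k : ℕ} (h : ∀ j < m, x j = .nat k) :
    ∑ j ∈ Finset.range m, x j = .nat (m * k) := by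
  induction m with
  | zero => simp [zero_def]
  | succ m ih =>
    rw [Finset.sum_range_succ, ih fun j hj => h j (by omega), h m (by omega), nat_add_nat,
      Nat.succ_mul]

variable [mΩ : MeasurableSpace Ω] {P : Measure Ω}

/-- The event that the process visits `z` infinitely often is measurable. -/
theorem IsOffspringFamily.measurableSet_frequently (hX : IsOffspringFamily P f X)
    (h0 : ∀ ω, Z 0 ω = .nat 1)
    (hZ : ∀ n ω, Z (n + 1) ω = deltaSum (fun j => X n j ω) (Z n ω)) (z : DeltaNat) :
    MeasurableSet {ω | ∃ᶠ n in atTop, Z n ω = z} := by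
  simp only [frequently_atTop, Set.ofPred_forall, Set.ofPred_exists]
  refine MeasurableSet.iInter fun a => MeasurableSet.iUnion fun b => ?_
  simp only [Set.ofPred_and]
  exact (MeasurableSet.const _).inter (hX.measurable_process h0 hZ b (measurableSet_singleton z))

variable [IsProbabilityMeasure P]

theorem IsOffspringFamily.measure_eq_zero_eq (hX : IsOffspringFamily P f X)
    (h0 : ∀ ω, Z 0 ω = .nat 1)
    (hZ : ∀ n ω, Z (n + 1) ω = deltaSum (fun j => X n j ω) (Z n ω)) (n : ℕ) :
    P {ω | Z n ω = .nat 0} = (DefectiveDist.iter f 0 n).gf 0 := by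
  have hm : MeasurableSet {ω | Z n ω = .nat 0} :=
    hX.measurable_process h0 hZ n (measurableSet_singleton _)
  rw [← hX.lintegral_powEval_process h0 hZ, ← lintegral_indicator_one hm]
  refine lintegral_congr fun ω => ?_
  rcases h : Z n ω with (_ | k) | _ <;> simp [h]

/-- Because `s ^ Δ = 0` even for `s = 1`, the function `1 ^ z` is the indicator of `z ≠ Δ`. -/
theorem IsOffspringFamily.measure_ne_delta_eq (hX : IsOffspringFamily P f X)
    (h0 : ∀ ω, Z 0 ω = .nat 1)
    (hZ : ∀ n ω, Z (n + 1) ω = deltaSum (fun j => X n j ω) (Z n ω)) (n : ℕ) :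
    P {ω | Z n ω ≠ .delta} = (DefectiveDist.iter f 0 n).gf 1 := by
  have hm : MeasurableSet {ω | Z n ω ≠ .delta} :=
    (hX.measurable_process h0 hZ n (measurableSet_singleton _)).compl
  rw [← hX.lintegral_powEval_process h0 hZ, ← lintegral_indicator_one hm]
  refine lintegral_congr fun ω => ?_
  rcases h : Z n ω with k | _ <;> simp [h]

theorem tendsto_of_tendsto_pow {x : ℕ → ℝ} (hx : ∀ i, 0 ≤ x i) {m : ℕ} (hm : 0 < m) {w : ℝ}
    (h : Tendsto (fun i => x i ^ m) atTop (𝓝 w)) :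
    Tendsto x atTop (𝓝 (w ^ (m⁻¹ : ℝ))) := by
  have h2 := h.rpow_const (p := (m⁻¹ : ℝ)) (Or.inr (by positivity))
  refine h2.congr fun i => ?_
  rw [Real.pow_rpow_inv_natCast (hx i) hm.ne']

/-- The bounds on `t` keep it in the range of every iterate on `[0, 1]`, so an orbit starts there.
Its martingale is eventually `1` on extinction, so only `t - P E` of the mean `t` is left for the
complement, which contains the recurrence event. -/
theorem IsOffspringFamily.exists_limit_of_extinction (hX : IsOffspringFamily P f X)
    (h0 : ∀ ω, Z 0 ω = .nat 1)
    (hZ : ∀ n ω, Z (n + 1) ω = deltaSum (fun j => X n j ω) (Z n ω))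
    (hf : ∀ n, 0 < (f n).derivOne) {m : ℕ} (hm : 0 < m) {t : ℝ≥0∞}
    (ht0 : P {ω | ∃ n, Z n ω = .nat 0} ≤ t)
    (ht1 : t ≤ P {ω | ∃ n, Z n ω = .nat 0} + P {ω | ∃ᶠ n in atTop, Z n ω = .nat m}) :
    ∃ (s : ℕ → ℝ≥0∞) (W : Ω → ℝ), (∀ n, s n ≤ 1) ∧ (∀ n, (f n).gf (s (n + 1)) = s n) ∧
      (∀ n, t ≤ P {ω | ∃ n, Z n ω = .nat 0} + s n) ∧
      Integrable W P ∧ (∀ᵐ ω ∂P, 0 ≤ W ω) ∧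
      (∀ᵐ ω ∂P, Tendsto (fun n => (powEval (s n) (Z n ω)).toReal) atTop (𝓝 (W ω))) ∧
      ∫ ω in {ω | ∃ᶠ n in atTop, Z n ω = .nat m}, W ω ∂P ≤
        t.toReal - P.real {ω | ∃ n, Z n ω = .nat 0} := by
  set E : Set Ω := {ω | ∃ n, Z n ω = .nat 0} with hE
  set A : Set Ω := {ω | ∃ᶠ n in atTop, Z n ω = .nat m} with hA
  have hAm : MeasurableSet A := hX.measurableSet_frequently h0 hZ _
  have hEm : MeasurableSet E := by
    rw [hE, Set.ofPred_exists]
    exact MeasurableSet.iUnion fun n => hX.measurable_process h0 hZ n (measurableSet_singleton _)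
  have hdisj : Disjoint E A := by
    rw [Set.disjoint_left]
    rintro ω ⟨n, hn⟩ hω
    obtain ⟨k, hk, hkm⟩ := frequently_atTop.1 hω n
    rw [process_eq_zero_of_le hZ hn hk] at hkm
    simp only [DeltaNat.nat.injEq] at hkm
    omega
  have hlow : ∀ n, (DefectiveDist.iter f 0 n).gf 0 ≤ P E := fun n => by
    rw [← hX.measure_eq_zero_eq h0 hZ]
    exact measure_mono fun ω hω => ⟨n, hω⟩
  have hup : ∀ n, P E + P A ≤ (DefectiveDist.iter f 0 n).gf 1 := fun n => by
    rw [← hX.measure_ne_delta_eq h0 hZ, ← measure_union hdisj hAm]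
    refine measure_mono ?_
    rintro ω (⟨k, hk⟩ | hω) hΔ
    · have h1 := process_eq_zero_of_le hZ hk (le_max_left k n)
      rw [process_eq_delta_of_le hZ hΔ (le_max_right k n)] at h1
      cases h1
    · obtain ⟨k, hk, hkm⟩ := frequently_atTop.1 hω n
      rw [process_eq_delta_of_le hZ hΔ hk] at hkm
      cases hkm
  obtain ⟨s, hst, hs1, hs⟩ := DefectiveDist.exists_orbit f hf
    (fun n => (hlow n).trans ht0) (fun n => ht1.trans (hup n))
  obtain ⟨W, hWi, hW0, hWint, hW⟩ := hX.exists_limit h0 hZ hs1 hs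
  refine ⟨s, W, hs1, hs, fun n => ?_, hWi, hW0, hW, ?_⟩
  · have h1 := DefectiveDist.gf_iter_eq f hs 0 n
    rw [zero_add, hst] at h1
    rw [← h1]
    refine ((DefectiveDist.iter f 0 n).gf_le_weight_zero_add (hs1 n)).trans ?_
    gcongr
    rw [← DefectiveDist.gf_zero]
    exact hlow n
  · have hE1 : ∫ ω in E, W ω ∂P = P.real E := by
      have : ∫ ω in E, W ω ∂P = ∫ ω in E, (1 : ℝ) ∂P := by
        refine setIntegral_congr_ae hEm ?_
        filter_upwards [hW] with ω hω hωE
        obtain ⟨k, hk⟩ := hωE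
        refine tendsto_nhds_unique hω (tendsto_const_nhds.congr' ?_)
        filter_upwards [eventually_ge_atTop k] with n hn
        simp [process_eq_zero_of_le hZ hk hn]
      rw [this]
      simp
    have hsplit := integral_add_compl hEm hWi
    have hAE : ∫ ω in A, W ω ∂P ≤ ∫ ω in Eᶜ, W ω ∂P :=
      setIntegral_mono_set hWi.integrableOn (ae_restrict_of_ae hW0)
        (LE.le.eventuallyLE hdisj.subset_compl_left)
    rw [hWint, hst, hE1] at hsplit
    linarith

theorem IsOffspringFamily.tsum_lt_top_of_frequently (hX : IsOffspringFamily P f X)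
    (h0 : ∀ ω, Z 0 ω = .nat 1)
    (hZ : ∀ n ω, Z (n + 1) ω = deltaSum (fun j => X n j ω) (Z n ω))
    (hf : ∀ n, 0 < (f n).derivOne) {m : ℕ} (hm : 0 < m)
    (hA : P {ω | ∃ᶠ n in atTop, Z n ω = .nat m} ≠ 0) :
    ∑' n, (1 - (f n).weight 1) < ∞ := by
  have hAm : MeasurableSet {ω | ∃ᶠ n in atTop, Z n ω = .nat m} :=
    hX.measurableSet_frequently h0 hZ _
  obtain ⟨e, V, he1, he, -, hVi, hV0, hV, hVA⟩ :=
    hX.exists_limit_of_extinction h0 hZ hf hm le_rfl le_self_add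
  obtain ⟨s, W, hs1, hs, hslow, hWi, hW0, hW, hWA⟩ :=
    hX.exists_limit_of_extinction h0 hZ hf hm
      (t := P {ω | ∃ n, Z n ω = .nat 0} + P {ω | ∃ᶠ n in atTop, Z n ω = .nat m} / 2)
      le_self_add (add_le_add_right ENNReal.half_le_self _)
  set E : Set Ω := {ω | ∃ n, Z n ω = .nat 0} with hE
  set A : Set Ω := {ω | ∃ᶠ n in atTop, Z n ω = .nat m} with hA'
  have hPA : 0 < P.real A := ENNReal.toReal_pos hA (by finiteness)
  have hdA : P A / 2 ≠ ∞ := (ENNReal.half_lt_self hA (by finiteness)).ne_top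
  have hδ : ∀ n, P.real A / 2 ≤ (s n).toReal := fun n => by
    have := (ENNReal.add_le_add_iff_left (by finiteness : P E ≠ ∞)).1 (hslow n)
    have := ENNReal.toReal_mono (ne_top_of_le_ne_top ENNReal.one_ne_top (hs1 n)) this
    simpa [ENNReal.toReal_div, Measure.real] using this
  -- The orbit `e` starts exactly at `P E`, so nothing of the mean is left outside extinction.
  have hV_zero : ∀ᵐ ω ∂P, ω ∈ A → V ω = 0 := by
    rw [← ae_restrict_iff' hAm]
    refine (setIntegral_eq_zero_iff_of_nonneg_ae (ae_restrict_of_ae hV0) hVi.integrableOn).1 ?_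
    refine le_antisymm (hVA.trans ?_) (integral_nonneg_of_ae (ae_restrict_of_ae hV0))
    exact (sub_self _).le
  by_contra hgoal
  have hW1 : ∀ᵐ ω ∂P, ω ∈ A → 1 ≤ W ω := by
    filter_upwards [hV_zero, hV, hW] with ω hVω hVt hWt hωA
    by_contra! hlt
    refine hgoal ?_
    obtain ⟨ν, hν, hνm⟩ := extraction_of_frequently_atTop hωA
    have tV := hVt.comp hν.tendsto_atTop
    have tW := hWt.comp hν.tendsto_atTop
    simp only [Function.comp_def, hνm, powEval_nat, ENNReal.toReal_pow] at tV tW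
    rw [hVω hωA] at tV
    have tV := tendsto_of_tendsto_pow (fun _ => ENNReal.toReal_nonneg) hm tV
    -- The orbit `s` stays above `P A / 2`, so along the visits to `m` its powers cannot tend to
    -- `0`.
    have hWpos : 0 < W ω := lt_of_lt_of_le (by positivity : 0 < (P.real A / 2) ^ m)
      (ge_of_tendsto' tW fun i => by gcongr; exact hδ _)
    have tW := tendsto_of_tendsto_pow (fun _ => ENNReal.toReal_nonneg) hm tW
    rw [Real.zero_rpow (by positivity)] at tV
    exact DefectiveDist.tsum_lt_top_of_orbits f hs he hs1 he1 hν (Real.rpow_pos_of_pos hWpos _)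
      (Real.rpow_lt_one hWpos.le hlt (by positivity)) tW tV
  -- This contradicts `hWA`, which leaves at most `P A / 2` for the integral over `A`.
  have hge : P.real A ≤ ∫ ω in A, W ω ∂P := by
    have h1 : ∫ ω in A, (1 : ℝ) ∂P ≤ ∫ ω in A, W ω ∂P :=
      setIntegral_mono_ae_restrict (integrable_const _).integrableOn hWi.integrableOn
        ((ae_restrict_iff' hAm).2 hW1)
    simpa using h1
  rw [ENNReal.toReal_add (by finiteness) hdA, ENNReal.toReal_div] at hWA
  have : (P E).toReal = P.real E := rfl
  have : (P A).toReal = P.real A := rfl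
  simp only [ENNReal.toReal_ofNat] at hWA
  linarith

end

/-! ### Summability traps the process in a positive state. -/

section

variable {Ω : Type*} {f : ℕ → DefectiveDist} {X : ℕ → ℕ → Ω → DeltaNat} {Z : ℕ → Ω → DeltaNat}

theorem process_eq_of_offspring_eq_one
    (hZ : ∀ n ω, Z (n + 1) ω = deltaSum (fun j => X n j ω) (Z n ω)) {ω : Ω} {N m : ℕ}
    (hN : Z N ω = .nat m) (h : ∀ n, N ≤ n → ∀ j < m, X n j ω = .nat 1) {n : ℕ} (hn : N ≤ n) :
    Z n ω = .nat m := by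
  induction n, hn using Nat.le_induction with
  | base => exact hN
  | succ n hn ih =>
    rw [hZ, ih]
    simpa [deltaSum] using sum_range_nat_one (h n hn)

variable [mΩ : MeasurableSpace Ω] {P : Measure Ω}

theorem IsOffspringFamily.measure_succ_pos (hX : IsOffspringFamily P f X)
    (h0 : ∀ ω, Z 0 ω = .nat 1)
    (hZ : ∀ n ω, Z (n + 1) ω = deltaSum (fun j => X n j ω) (Z n ω)) {n m k : ℕ}
    (hm : 0 < P {ω | Z n ω = .nat m}) (hk : 0 < (f n).weight k) :
    0 < P {ω | Z (n + 1) ω = .nat (m * k)} := by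
  have hprod : P (⋂ j ∈ Finset.range m, X n j ⁻¹' {.nat k}) = (f n).weight k ^ m := by
    have hind : iIndepFun (fun j => X n j) P :=
      hX.indep.precomp (g := fun j : ℕ => (n, j)) fun a b h => by simpa using h
    rw [hind.measure_inter_preimage_eq_mul (Finset.range m) fun _ _ => measurableSet_singleton _]
    have : ∀ j, P (X n j ⁻¹' {.nat k}) = (f n).weight k := fun j => hX.law n j k
    simp [this]
  have hmeas : MeasurableSet[offspringSigma X (futureIndices n)]
      (⋂ j ∈ Finset.range m, X n j ⁻¹' {.nat k}) :=
    Finset.measurableSet_biInter _ fun j _ =>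
      measurable_offspringSigma (S := futureIndices n) (j := j) (Set.mem_ofPred.2 le_rfl)
        (measurableSet_singleton _)
  have hmul := (Indep_iff _ _ P).1 (hX.indep_sigma (disjoint_past_future n)) _ _
    (measurable_past h0 hZ n (measurableSet_singleton (.nat m))) hmeas
  have hpos : 0 < P (Z n ⁻¹' {.nat m} ∩ ⋂ j ∈ Finset.range m, X n j ⁻¹' {.nat k}) := by
    rw [hmul, hprod]
    exact ENNReal.mul_pos hm.ne' (pow_ne_zero m hk.ne')
  refine hpos.trans_le (measure_mono ?_)
  rintro ω ⟨h1, h2⟩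
  simp only [Set.mem_iInter, Finset.mem_range, Set.mem_preimage, Set.mem_singleton_iff] at h1 h2
  simp only [Set.mem_ofPred, hZ, h1]
  exact sum_range_nat_one h2

variable [IsProbabilityMeasure P]

theorem IsOffspringFamily.measure_ne_one (hX : IsOffspringFamily P f X) (n j : ℕ) :
    P {ω | X n j ω ≠ .nat 1} = 1 - (f n).weight 1 := by
  rw [← hX.law n j 1]
  exact prob_compl_eq_one_sub (hX.measurable n j (measurableSet_singleton _))

theorem IsOffspringFamily.ae_eventually_eq (hX : IsOffspringFamily P f X)
    (hZ : ∀ n ω, Z (n + 1) ω = deltaSum (fun j => X n j ω) (Z n ω))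
    (hsum : ∑' n, (1 - (f n).weight 1) < ∞) :
    ∀ᵐ ω ∂P, ∀ m, (∃ᶠ n in atTop, Z n ω = .nat m) → ∀ᶠ n in atTop, Z n ω = .nat m := by
  have h : ∀ᵐ ω ∂P, ∀ j, ∀ᶠ n in atTop, X n j ω = .nat 1 := by
    refine ae_all_iff.2 fun j => ?_
    have := ae_eventually_notMem (μ := P) (s := fun n => {ω | X n j ω ≠ .nat 1})
      (by simpa only [hX.measure_ne_one] using hsum.ne)
    simpa using this
  filter_upwards [h] with ω hω m hm
  have hall : ∀ᶠ n in atTop, ∀ j ∈ Finset.range m, X n j ω = .nat 1 :=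
    (Filter.eventually_all_finset _).2 fun j _ => hω j
  obtain ⟨N, hN⟩ := eventually_atTop.1 hall
  obtain ⟨k, hk, hkm⟩ := frequently_atTop.1 hm N
  filter_upwards [eventually_ge_atTop k] with n hn
  exact process_eq_of_offspring_eq_one hZ hkm
    (fun i hi j hj => hN i (hk.trans hi) j (Finset.mem_range.2 hj)) hn

theorem IsOffspringFamily.exists_measure_eq_pos (hX : IsOffspringFamily P f X)
    (h0 : ∀ ω, Z 0 ω = .nat 1)
    (hZ : ∀ n ω, Z (n + 1) ω = deltaSum (fun j => X n j ω) (Z n ω))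
    (hf : ∀ n, 0 < (f n).derivOne) (n : ℕ) :
    ∃ m, 0 < m ∧ 0 < P {ω | Z n ω = .nat m} := by
  induction n with
  | zero => exact ⟨1, one_pos, by simp [h0]⟩
  | succ n ih =>
    obtain ⟨m, hm, hmP⟩ := ih
    obtain ⟨k, hk, hkf⟩ := (f n).exists_weight_pos (hf n)
    exact ⟨m * k, Nat.mul_pos hm hk, hX.measure_succ_pos h0 hZ hmP hkf⟩

theorem IsOffspringFamily.exists_measure_eventually_eq_pos (hX : IsOffspringFamily P f X)
    (h0 : ∀ ω, Z 0 ω = .nat 1)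
    (hZ : ∀ n ω, Z (n + 1) ω = deltaSum (fun j => X n j ω) (Z n ω))
    (hf : ∀ n, 0 < (f n).derivOne) (hsum : ∑' n, (1 - (f n).weight 1) < ∞) :
    ∃ m, 0 < m ∧ 0 < P {ω | ∀ᶠ n in atTop, Z n ω = .nat m} := by
  have htail := ENNReal.tendsto_sum_nat_add (fun n => 1 - (f n).weight 1) hsum.ne
  obtain ⟨N₀, hN₀⟩ := (htail.eventually_lt_const one_pos).exists
  have hpos : ∀ n, N₀ ≤ n → 0 < (f n).weight 1 := by
    intro n hn
    obtain ⟨r, rfl⟩ := Nat.exists_eq_add_of_le' hn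
    by_contra! h
    have := (ENNReal.le_tsum (f := fun k => 1 - (f (k + N₀)).weight 1) r).trans_lt hN₀
    simp [nonpos_iff_eq_zero.1 h] at this
  obtain ⟨m, hm, hmP⟩ := hX.exists_measure_eq_pos h0 hZ hf N₀
  have htail' : Tendsto (fun i => ∑' k, ∑ _j ∈ Finset.range m, (1 - (f (k + i)).weight 1))
      atTop (𝓝 0) := by
    have := ENNReal.Tendsto.const_mul htail (Or.inr (ENNReal.natCast_ne_top m))
    simpa [ENNReal.tsum_mul_left] using this
  -- Beyond `N` a union bound makes the first `m` individuals of all generations have one child each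
  -- with positive probability; `N ≥ N₀` lets the state `m`, possible at time `N₀`, persist until
  -- `N`.
  obtain ⟨N, hN1, hN⟩ := ((htail'.eventually_lt_const one_pos).and
    (eventually_ge_atTop N₀)).exists
  have hNP : 0 < P {ω | Z N ω = .nat m} := by
    clear hN1
    induction N, hN using Nat.le_induction with
    | base => exact hmP
    | succ n hn ih => simpa using hX.measure_succ_pos h0 hZ ih (hpos n hn)
  set T : Set Ω := ⋂ k, ⋂ j ∈ Finset.range m, X (k + N) j ⁻¹' {.nat 1} with hT
  have hTm : MeasurableSet[offspringSigma X (futureIndices N)] T :=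
    MeasurableSet.iInter fun k => Finset.measurableSet_biInter _ fun j _ =>
      measurable_offspringSigma (S := futureIndices N) (j := j)
        (Set.mem_ofPred.2 (Nat.le_add_left N k)) (measurableSet_singleton _)
  have hTc : P Tᶜ < 1 := by
    refine lt_of_le_of_lt ?_ hN1
    rw [hT]
    simp only [Set.compl_iInter]
    refine (measure_iUnion_le _).trans (ENNReal.tsum_le_tsum fun k => ?_)
    refine (measure_biUnion_finset_le _ _).trans (Finset.sum_le_sum fun j _ => ?_)
    exact (hX.measure_ne_one (k + N) j).le
  have hTpos : P T ≠ 0 := by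
    intro h
    rw [prob_compl_eq_one_sub (hX.sigma_le _ _ hTm), h] at hTc
    simp at hTc
  have hmul := (Indep_iff _ _ P).1 (hX.indep_sigma (disjoint_past_future N)) _ _
    (measurable_past h0 hZ N (measurableSet_singleton (.nat m))) hTm
  have hfin : 0 < P (Z N ⁻¹' {.nat m} ∩ T) := by
    rw [hmul]
    exact ENNReal.mul_pos hNP.ne' hTpos
  refine ⟨m, hm, hfin.trans_le (measure_mono ?_)⟩
  rintro ω ⟨h1, h2⟩
  simp only [hT, Set.mem_iInter, Finset.mem_range, Set.mem_preimage, Set.mem_singleton_iff]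
    at h1 h2
  refine eventually_atTop.2 ⟨N, fun n hn => process_eq_of_offspring_eq_one hZ h1 ?_ hn⟩
  intro i hi j hj
  obtain ⟨r, rfl⟩ := Nat.exists_eq_add_of_le' hi
  exact h2 r j hj

end

/-! ### The limit in the one-point compactification and the conclusion. -/

open Classical in
/-- The limit of a sequence in `ℕ₀ ∪ {Δ}`: its eventual value if there is one, and `∞`
otherwise. -/
noncomputable def DeltaNat.limitPoint (z : ℕ → DeltaNat) : ExtDeltaNat :=
  if h : ∃ y, ∀ᶠ n in atTop, z n = y then ((h.choose : DeltaNat) : ExtDeltaNat) else OnePoint.infty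

theorem DeltaNat.limitPoint_eq_coe_iff (z : ℕ → DeltaNat) (y : DeltaNat) :
    limitPoint z = (y : ExtDeltaNat) ↔ ∀ᶠ n in atTop, z n = y := by
  unfold limitPoint
  split_ifs with h
  · rw [OnePoint.coe_eq_coe]
    refine ⟨fun e => e ▸ h.choose_spec, fun hy => ?_⟩
    obtain ⟨n, h1, h2⟩ := (h.choose_spec.and hy).exists
    exact h1.symm.trans h2
  · exact ⟨fun e => absurd e (OnePoint.infty_ne_coe y), fun hy => absurd ⟨y, hy⟩ h⟩

/-- Without an eventual value, the hypothesis lets each state be visited only finitely often, which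
is convergence to `∞` because compact subsets of a discrete space are finite. -/
theorem DeltaNat.tendsto_limitPoint {z : ℕ → DeltaNat}
    (h : ∀ y, (∃ᶠ n in atTop, z n = y) → ∀ᶠ n in atTop, z n = y) :
    Tendsto (fun n => (z n : ExtDeltaNat)) atTop (𝓝 (limitPoint z)) := by
  by_cases hz : ∃ y, ∀ᶠ n in atTop, z n = y
  · obtain ⟨y, hy⟩ := hz
    rw [(limitPoint_eq_coe_iff z y).2 hy]
    refine tendsto_const_nhds.congr' ?_
    filter_upwards [hy] with n hn
    rw [hn]
  · have e : limitPoint z = OnePoint.infty := dif_neg hz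
    rw [e]
    refine OnePoint.tendsto_coe_infty.comp ?_
    rw [coclosedCompact_eq_cocompact, cocompact_eq_cofinite]
    refine le_cofinite_iff_eventually_ne.2 fun y => ?_
    by_contra hy
    exact hz ⟨y, h y (not_eventually.1 hy |>.mono fun n hn => not_not.1 hn)⟩

theorem DeltaNat.measurable_limitPoint {Ω : Type*} [MeasurableSpace Ω] {Z : ℕ → Ω → DeltaNat}
    (hZ : ∀ n, Measurable (Z n)) : Measurable fun ω => limitPoint fun n => Z n ω := by
  have : Countable ExtDeltaNat := inferInstanceAs (Countable (Option DeltaNat))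
  have hcoe : ∀ y : DeltaNat, MeasurableSet
      ((fun ω => limitPoint fun n => Z n ω) ⁻¹' {(y : ExtDeltaNat)}) := by
    intro y
    have e : (fun ω => limitPoint fun n => Z n ω) ⁻¹' {(y : ExtDeltaNat)} =
        ⋃ N, ⋂ n, ⋂ (_ : N ≤ n), Z n ⁻¹' {y} := by
      ext ω
      simp [limitPoint_eq_coe_iff, eventually_atTop]
    rw [e]
    exact MeasurableSet.iUnion fun N => MeasurableSet.iInter fun n => MeasurableSet.iInter fun _ =>
      hZ n (measurableSet_singleton y)
  refine measurable_to_countable' fun x => ?_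
  induction x using OnePoint.rec with
  | coe y => exact hcoe y
  | infty =>
    have e : (fun ω => limitPoint fun n => Z n ω) ⁻¹' {(OnePoint.infty : ExtDeltaNat)} =
        (⋃ y : DeltaNat, (fun ω => limitPoint fun n => Z n ω) ⁻¹' {(y : ExtDeltaNat)})ᶜ := by
      ext ω
      simp only [Set.mem_preimage, Set.mem_singleton_iff, Set.mem_compl_iff, Set.mem_iUnion,
        not_exists]
      refine ⟨fun h y => h ▸ OnePoint.infty_ne_coe y, fun h => ?_⟩
      generalize limitPoint (fun n => Z n ω) = x at h
      induction x using OnePoint.rec with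
      | coe y => exact absurd rfl (h y)
      | infty => rfl
    rw [e]
    exact (MeasurableSet.iUnion hcoe).compl

theorem mainTheorem1 {Ω : Type*} [MeasurableSpace Ω] (P : Measure Ω) [IsProbabilityMeasure P]
    (f : ℕ → DefectiveDist) (hf : ∀ n, 0 < (f n).derivOne ∧ (f n).derivOne < ∞)
    (Z : ℕ → Ω → DeltaNat) (hZ : IsDGWPVE P f Z) :
    ∃ Zinf : Ω → ExtDeltaNat, Measurable Zinf ∧
      (∀ᵐ ω ∂P, Tendsto (fun n => ((Z n ω : DeltaNat) : ExtDeltaNat)) atTop (𝓝 (Zinf ω))) ∧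
      (0 < P {ω | ∃ k : ℕ, 0 < k ∧ Zinf ω = ((DeltaNat.nat k : DeltaNat) : ExtDeltaNat)} ↔
        ∑' n, (1 - (f n).weight 1) < ∞) := by
  obtain ⟨X, hX, h0, hZ⟩ := hZ
  have hf' : ∀ n, 0 < (f n).derivOne := fun n => (hf n).1
  refine ⟨fun ω => limitPoint fun n => Z n ω,
    measurable_limitPoint (hX.measurable_process h0 hZ), ?_, ?_⟩
  · have hpos : ∀ᵐ ω ∂P, ∀ m, 0 < m → (∃ᶠ n in atTop, Z n ω = .nat m) →
        ∀ᶠ n in atTop, Z n ω = .nat m := by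
      by_cases hsum : ∑' n, (1 - (f n).weight 1) < ∞
      · filter_upwards [hX.ae_eventually_eq hZ hsum] with ω hω m _
        exact hω m
      · refine ae_all_iff.2 fun m => ?_
        by_cases hm : 0 < m
        · have hnull : P {ω | ∃ᶠ n in atTop, Z n ω = .nat m} = 0 := by
            by_contra h
            exact hsum (hX.tsum_lt_top_of_frequently h0 hZ hf' hm h)
          filter_upwards [measure_eq_zero_iff_ae_notMem.1 hnull] with ω hω _ h
          exact absurd h hω
        · exact Eventually.of_forall fun ω h => absurd h hm
    filter_upwards [hpos] with ω hω
    refine tendsto_limitPoint fun y hy => ?_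
    cases y with
    | nat m =>
      obtain rfl | hm := Nat.eq_zero_or_pos m
      · obtain ⟨n, hn⟩ := hy.exists
        exact eventually_atTop.2 ⟨n, fun k hk => process_eq_zero_of_le hZ hn hk⟩
      · exact hω m hm hy
    | delta =>
      obtain ⟨n, hn⟩ := hy.exists
      exact eventually_atTop.2 ⟨n, fun k hk => process_eq_delta_of_le hZ hn hk⟩
  · simp only [limitPoint_eq_coe_iff]
    constructor
    · intro hP
      by_contra hsum
      refine hP.ne' (measure_mono_null (t := ⋃ k : ℕ, {ω | 0 < k ∧ ∃ᶠ n in atTop, Z n ω = .nat k})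
        ?_ (measure_iUnion_null fun k => ?_))
      · rintro ω ⟨k, hk, hω⟩
        exact Set.mem_iUnion.2 ⟨k, hk, hω.frequently⟩
      · by_contra h
        have hk : 0 < k := by
          by_contra hk
          simp [hk] at h
        simp only [hk, true_and] at h
        exact hsum (hX.tsum_lt_top_of_frequently h0 hZ hf' hk h)
    · intro hsum
      obtain ⟨m, hm, hmP⟩ := hX.exists_measure_eventually_eq_pos h0 hZ hf' hsum
      exact hmP.trans_le (measure_mono fun ω hω => ⟨m, hm, hω⟩)
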